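/- Let $n\ge 3$, $m\ge 1$ and $\varepsilon_1,\dots,\varepsilon_n\in\{1,-1\}$, and let $g=\sum_i\varepsilon_i\,dx_i^2$ be the pseudo-Euclidean metric on $\mathbb{R}^n$. Let $\alpha\in\mathbb{R}^n$ satisfy $\sum_{i}\varepsilon_i\alpha_i^2=\varepsilon_{i_0}$ for some index $i_0$, and put $\xi(x)=\sum_i\alpha_ix_i$. Let $(F^m,g_F)$ be an $m$-dimensional Ricci-flat semi-Riemannian manifold. Let $k,c_1,c_2,c_3>0$ and $c\in\mathbb{R}$, put $a=(n-2)k-m$ and $b=m(2k+1)-(n-2)k^2$, assume $k+a\ne 0$, and put $$N=\frac{a^2-b}{2(k+a)}.$$ Then $a^2+b+2ka>0$ and $a-N=\frac{a^2+b+2ka}{2(k+a)}\neq 0$. Let $U=\{x\in\mathbb{R}^n : (a-N)\xi(x)+c>0\}$; this is the half-space $\xi>-\frac{2c(k+a)}{a^2+b+2ka}$ if $k+a>0$, and the half-space $\xi<-\frac{2c(k+a)}{a^2+b+2ka}$ if $k+a<0$. On $U$ the functions $$f=c_1[(a-N)\xi+c]^{-\frac{1}{a-N}},\qquad h=c_2[(a-N)\xi+c]^{-\frac{N}{a-N}},\qquad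 \varphi=c_3[(a-N)\xi+c]^{-\frac{k}{a-N}}$$ are smooth and positive, and the warped product $U\times_fF$ with the semi-Riemannian metric $\widetilde g=\varphi^{-2}g+f^2g_F$ and the function $h$ (extended to $U\times F$ as constant along $F$) is quasi-Einstein with $r=1$ and $\rho=0$, that is, $$\mathrm{Ric}_{\widetilde g}-\frac1h\,\mathrm{Hess}_{\widetilde g}h=0\quad\text{on } U\times F.$$ -/

import Mathlib

set_option maxSynthPendingDepth 3

open scoped Manifold ContDiff

noncomputable section

namespace SemiRiem

/-! ### Levi-Civita calculus of a metric on an open piece of a vector space -/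

section Local

variable {E : Type*} [NormedAddCommGroup E] [NormedSpace ℝ E]

/-- Christoffel symbols of the first kind of a metric `G` on `E`:
`Γ(v, w; z) = ½ (∂_v G(w, z) + ∂_w G(v, z) - ∂_z G(v, w))`. -/
def christoffelFirst (G : E → E →L[ℝ] E →L[ℝ] ℝ) (u : E) : E →L[ℝ] E →L[ℝ] E →L[ℝ] ℝ :=
  let D : E →L[ℝ] E →L[ℝ] E →L[ℝ] ℝ := fderiv ℝ G u
  let τ : (E →L[ℝ] E →L[ℝ] ℝ) →L[ℝ] (E →L[ℝ] E →L[ℝ] ℝ) :=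
    (ContinuousLinearMap.flipₗᵢ ℝ E E ℝ).toContinuousLinearEquiv
  let T : E →L[ℝ] E →L[ℝ] E →L[ℝ] ℝ := τ.comp D.flip
  (1 / 2 : ℝ) • (D + D.flip - T)

theorem christoffelFirst_apply (G : E → E →L[ℝ] E →L[ℝ] ℝ) (u v w z : E) :
    christoffelFirst G u v w z
      = (1 / 2) * (fderiv ℝ G u v w z + fderiv ℝ G u w v z - fderiv ℝ G u z v w) := by
  simp [christoffelFirst]

/-- Christoffel symbols of the second kind: `Γ(v, w)` is the vector obtained from
`christoffelFirst` by raising the last index, i.e. `G(Γ(v, w), z) = Γ(v, w; z)`. -/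
def christoffel (G : E → E →L[ℝ] E →L[ℝ] ℝ) (u : E) : E →L[ℝ] E →L[ℝ] E :=
  (ContinuousLinearMap.compL ℝ E (E →L[ℝ] ℝ) E (G u).inverse).comp (christoffelFirst G u)

theorem christoffel_apply (G : E → E →L[ℝ] E →L[ℝ] ℝ) (u v w : E) :
    christoffel G u v w = (G u).inverse (christoffelFirst G u v w) := rfl

/-- The endomorphism `X ↦ R(X, v) w` of the Riemann curvature tensor of `G` at `u`. -/
def curvatureOp (G : E → E →L[ℝ] E →L[ℝ] ℝ) (u v w : E) : E →L[ℝ] E :=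
  ((fderiv ℝ (christoffel G) u).flip v).flip w - (fderiv ℝ (christoffel G) u v).flip w
    + (christoffel G u).flip (christoffel G u v w)
    - (christoffel G u v).comp ((christoffel G u).flip w)

/-- `R(X, v) w = ∂_X Γ(v, w) - ∂_v Γ(X, w) + Γ(X, Γ(v, w)) - Γ(v, Γ(X, w))`, the coordinate form
of `∇_X ∇_v w - ∇_v ∇_X w` for constant vector fields. -/
theorem curvatureOp_apply (G : E → E →L[ℝ] E →L[ℝ] ℝ) (u v w X : E) :
    curvatureOp G u v w X
      = fderiv ℝ (christoffel G) u X v w - fderiv ℝ (christoffel G) u v X w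
        + christoffel G u X (christoffel G u v w) - christoffel G u v (christoffel G u X w) := by
  simp [curvatureOp]

/-- Ricci curvature `Ric(v, w) = tr (X ↦ R(X, v) w)` of `G` at `u`. -/
def ricciLocal (G : E → E →L[ℝ] E →L[ℝ] ℝ) (u v w : E) : ℝ :=
  LinearMap.trace ℝ E (curvatureOp G u v w : E →ₗ[ℝ] E)

/-- Hessian `∂_v ∂_w h - dh (Γ(v, w))` of a function with respect to `G` at `u`. -/
def hessLocal (G : E → E →L[ℝ] E →L[ℝ] ℝ) (h : E → ℝ) (u v w : E) : ℝ :=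
  fderiv ℝ (fderiv ℝ h) u v w - fderiv ℝ h u (christoffel G u v w)

end Local

/-! ### Semi-Riemannian metrics on manifolds (without boundary) -/

section Manifold

variable {E : Type*} [NormedAddCommGroup E] [NormedSpace ℝ E]
  {H : Type*} [TopologicalSpace H] (I : ModelWithCorners ℝ E H)
  {M : Type*} [TopologicalSpace M] [ChartedSpace H M]

/-- The differential at `u` of the inverse of the preferred chart around `x`, as a map from `E` to the
tangent space at `y = (extChartAt I x).symm u`. Mathlib's `TangentSpace I y` is by definition the
model space `E`, by means of the preferred chart around `y`; so this is the derivative at `u` of the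
transition map from the chart around `x` to the chart around `y`. -/
def chartDeriv (x : M) (u : E) : E →L[ℝ] E :=
  fderiv ℝ (extChartAt I ((extChartAt I x).symm u) ∘ (extChartAt I x).symm) u

/-- The components in the preferred chart around `x` of a field `g` of bilinear forms on the tangent
spaces of `M` (each of which is `E`): the pull-back of `g` under the inverse of the chart. -/
def inChart (g : M → E →L[ℝ] E →L[ℝ] ℝ) (x : M) (u : E) : E →L[ℝ] E →L[ℝ] ℝ :=
  (g ((extChartAt I x).symm u)).bilinearComp (chartDeriv I x u) (chartDeriv I x u)

theorem inChart_apply (g : M → E →L[ℝ] E →L[ℝ] ℝ) (x : M) (u v w : E) :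
    inChart I g x u v w
      = g ((extChartAt I x).symm u) (chartDeriv I x u v) (chartDeriv I x u w) := rfl

/-- At the base point of the chart the components of `g` are `g` itself. -/
theorem inChart_self [I.Boundaryless] (g : M → E →L[ℝ] E →L[ℝ] ℝ) (x : M) :
    inChart I g x (extChartAt I x x) = g x := by
  have key : chartDeriv I x (extChartAt I x x) = ContinuousLinearMap.id ℝ E := by
    have h : (extChartAt I ((extChartAt I x).symm (extChartAt I x x)) ∘ (extChartAt I x).symm)
        =ᶠ[nhds (extChartAt I x x)] id := by
      filter_upwards [extChartAt_target_mem_nhds (I := I) x] with u hu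
      simp only [extChartAt_to_inv]
      exact (extChartAt I x).right_inv hu
    rw [chartDeriv, h.fderiv_eq, fderiv_id]
  ext v w
  rw [inChart_apply, key, extChartAt_to_inv]
  rfl

/-- The Ricci tensor of `g` at `x`, computed in the preferred chart around `x`. -/
def ricci (g : M → E →L[ℝ] E →L[ℝ] ℝ) (x : M) (v w : E) : ℝ :=
  ricciLocal (inChart I g x) (extChartAt I x x) v w

/-- The Hessian of `h` with respect to `g` at `x`, computed in the preferred chart around `x`. -/
def hess (g : M → E →L[ℝ] E →L[ℝ] ℝ) (h : M → ℝ) (x : M) (v w : E) : ℝ :=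
  hessLocal (inChart I g x) (h ∘ (extChartAt I x).symm) (extChartAt I x x) v w

/-- `g` is a semi-Riemannian metric on the open submanifold `S` of `M`: a smooth field of
symmetric nondegenerate bilinear forms of constant index. (By Sylvester's law of inertia, the
forms at two points have the same index iff the two tangent spaces are isometric.) -/
structure IsSemiRiemannianOn (g : M → E →L[ℝ] E →L[ℝ] ℝ) (S : Set M) : Prop where
  isOpen : IsOpen S
  symm : ∀ x ∈ S, ∀ v w : E, g x v w = g x w v
  nondegenerate : ∀ x ∈ S, ∀ v : E, (∀ w : E, g x v w = 0) → v = 0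
  constIndex : ∀ x ∈ S, ∀ y ∈ S, ∃ L : E ≃ₗ[ℝ] E,
    ∀ v w : E, g y (L v) (L w) = g x v w
  smooth : ∀ x ∈ S, ContDiffAt ℝ ∞ (inChart I g x) (extChartAt I x x)

/-- `(M, g)` is a Ricci-flat semi-Riemannian manifold. -/
structure IsRicciFlat (g : M → E →L[ℝ] E →L[ℝ] ℝ) : Prop where
  semiRiemannian : IsSemiRiemannianOn I g Set.univ
  ricci_eq_zero : ∀ (x : M) (v w : E), ricci I g x v w = 0

/-- `(S, g, h)` is a quasi-Einstein semi-Riemannian manifold: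
`Ric_g - (r / h) Hess_g h = ρ g` on the open submanifold `S`, with `h` smooth and positive. -/
structure IsQuasiEinsteinOn (g : M → E →L[ℝ] E →L[ℝ] ℝ) (h : M → ℝ) (r ρ : ℝ) (S : Set M) : Prop where
  semiRiemannian : IsSemiRiemannianOn I g S
  smooth : ContMDiffOn I 𝓘(ℝ, ℝ) ∞ h S
  pos : ∀ x ∈ S, 0 < h x
  eqn : ∀ x ∈ S, ∀ v w : E,
    ricci I g x v w - r / h x * hess I g h x v w = ρ * g x v w

end Manifold

/-! ### Pseudo-Euclidean spaces and warped products -/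

/-- The pseudo-Euclidean metric `g_{ij} = δ_{ij} ε_i` on `ℝⁿ`. -/
def pseudoEuclidean {n : ℕ} (ε : Fin n → ℝ) :
    EuclideanSpace ℝ (Fin n) →L[ℝ] EuclideanSpace ℝ (Fin n) →L[ℝ] ℝ :=
  ∑ i, ε i • (EuclideanSpace.proj i : EuclideanSpace ℝ (Fin n) →L[ℝ] ℝ).smulRight
    (EuclideanSpace.proj i : EuclideanSpace ℝ (Fin n) →L[ℝ] ℝ)

theorem pseudoEuclidean_apply {n : ℕ} (ε : Fin n → ℝ) (v w : EuclideanSpace ℝ (Fin n)) :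
    pseudoEuclidean ε v w = ∑ i, ε i * (v i * w i) := by
  simp [pseudoEuclidean]

/-- The conformal metric `φ⁻² g` on `ℝⁿ`, with `g` pseudo-Euclidean. -/
def conformal {n : ℕ} (ε : Fin n → ℝ) (φ : EuclideanSpace ℝ (Fin n) → ℝ) :
    EuclideanSpace ℝ (Fin n) →
      EuclideanSpace ℝ (Fin n) →L[ℝ] EuclideanSpace ℝ (Fin n) →L[ℝ] ℝ :=
  fun x => (1 / φ x ^ 2) • pseudoEuclidean ε

section Warped

variable {E₁ E₂ B F : Type*}
  [NormedAddCommGroup E₁] [NormedSpace ℝ E₁] [NormedAddCommGroup E₂] [NormedSpace ℝ E₂]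

/-- The warped product metric `g_B + f² g_F` on `B × F`, whose tangent spaces are the products
of those of `B` and `F`. -/
def warped (gB : B → E₁ →L[ℝ] E₁ →L[ℝ] ℝ) (f : B → ℝ) (gF : F → E₂ →L[ℝ] E₂ →L[ℝ] ℝ) :
    B × F → (E₁ × E₂) →L[ℝ] (E₁ × E₂) →L[ℝ] ℝ :=
  fun p =>
    (gB p.1).bilinearComp (ContinuousLinearMap.fst ℝ E₁ E₂) (ContinuousLinearMap.fst ℝ E₁ E₂)
      + (f p.1 ^ 2) • (gF p.2).bilinearComp
          (ContinuousLinearMap.snd ℝ E₁ E₂) (ContinuousLinearMap.snd ℝ E₁ E₂)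

theorem warped_apply (gB : B → E₁ →L[ℝ] E₁ →L[ℝ] ℝ) (f : B → ℝ)
    (gF : F → E₂ →L[ℝ] E₂ →L[ℝ] ℝ) (p : B × F) (v w : E₁ × E₂) :
    warped gB f gF p v w = gB p.1 v.1 w.1 + f p.1 ^ 2 * gF p.2 v.2 w.2 := rfl

end Warped

end SemiRiem

end

/-! Write `s = δξ + c` with `δ = a - N`. Each of `f`, `h`, `φ` is a constant times `s ^ (-p/δ)`,
with `p = 1, N, k` respectively, so its differential is `-(p/s)` times itself times `dξ`: the `δ` in
the exponent cancels against `ds = δ dξ`. Hence the Christoffel symbols of `φ⁻²η + f² g_F` have a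
closed form in `s⁻¹`, `φ² f²`, `dξ`, `η` and the Christoffel symbols of `g_F`
(`christoffel_powerMetric`), which can be differentiated once more (`PowerData.fderiv_christoffel`).

The Ricci tensor is a trace over a product, so only the two diagonal blocks of the curvature
operator count. Apart from the curvature operator of `g_F`, whose trace vanishes, each block is a
sum of rank-one maps and a multiple of the identity (`trace_base_block`, `trace_fibre_block`).
Together with `hessLocal_eq`, this makes `Ric - Hess h / h` a combination of `dξ ⊗ dξ`, `η` and
`g_F`. The coefficients of `η` and `g_F` are both multiples of `δ + N - ((n-2)k - m)`, zero because
`δ + N = a`. The coefficient of `dξ ⊗ dξ` is zero exactly when `2N(k + a) = a² - b`, which is the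
choice of `N`.

On a manifold fibre the Ricci tensor and Hessian depend only on the germ of the metric in a chart,
and near the base point a product chart turns the warped metric into a warped product of chart
components (`eventually_inChart_warped`). -/

noncomputable section

namespace SemiRiem

open Filter Topology

/-! ### Regularity, symmetry and locality of the Levi-Civita calculus in a vector space. -/

section LocalCalculus

variable {E : Type*} [NormedAddCommGroup E] [NormedSpace ℝ E]

theorem hasFDerivAt_apply_apply {E' K K' : Type*} [NormedAddCommGroup E'] [NormedSpace ℝ E']
    [NormedAddCommGroup K] [NormedSpace ℝ K] [NormedAddCommGroup K'] [NormedSpace ℝ K']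
    {T : E → E' →L[ℝ] K →L[ℝ] K'} {T' : E →L[ℝ] E' →L[ℝ] K →L[ℝ] K'} {u : E}
    (h : HasFDerivAt T T' u) (v : E') (w : K) :
    HasFDerivAt (fun y => T y v w) ((T'.flip v).flip w) u := by
  refine ((h.clm_apply (hasFDerivAt_const v u)).clm_apply (hasFDerivAt_const w u)).congr_fderiv ?_
  ext
  simp

theorem isInvertible_of_nondegenerate [FiniteDimensional ℝ E] (B : E →L[ℝ] E →L[ℝ] ℝ)
    (hB : ∀ v, (∀ w, B v w = 0) → v = 0) : B.IsInvertible := by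
  have hinj : Function.Injective (B : E →ₗ[ℝ] (E →L[ℝ] ℝ)) := by
    rw [injective_iff_map_eq_zero]
    intro v hv
    apply hB
    intro w
    have : B v = 0 := hv
    simp [this]
  have hfin : Module.finrank ℝ E = Module.finrank ℝ (E →L[ℝ] ℝ) := by
    rw [← (LinearMap.toContinuousLinearMap (𝕜 := ℝ) (E := E) (F' := ℝ)).finrank_eq]
    exact (Subspace.dual_finrank_eq (K := ℝ) (V := E)).symm
  refine ⟨(LinearMap.linearEquivOfInjective _ hinj hfin).toContinuousLinearEquiv, ?_⟩
  ext v w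
  rfl

theorem eventually_isInvertible [CompleteSpace E] {G : E → E →L[ℝ] E →L[ℝ] ℝ} {u : E}
    (hG : ContinuousAt G u) (hi : (G u).IsInvertible) : ∀ᶠ y in 𝓝 u, (G y).IsInvertible := by
  obtain ⟨e, he⟩ := hi
  have := e.nhds
  rw [he] at this
  filter_upwards [hG this] with y hy
  obtain ⟨e', he'⟩ := hy
  exact ⟨e', he'⟩

/-- The Koszul formula determines the vector by nondegeneracy, so a proposed closed form can be
checked by pairing it with `z`, without inverting the metric. -/
theorem christoffel_eq {G : E → E →L[ℝ] E →L[ℝ] ℝ} {u v w Y : E} (hi : (G u).IsInvertible)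
    (h : ∀ z, G u Y z
      = (1 / 2) * (fderiv ℝ G u v w z + fderiv ℝ G u w v z - fderiv ℝ G u z v w)) :
    christoffel G u v w = Y := by
  rw [christoffel_apply, hi.inverse_apply_eq]
  ext z
  rw [christoffelFirst_apply, h]

theorem apply_christoffel {G : E → E →L[ℝ] E →L[ℝ] ℝ} {u : E} (hi : (G u).IsInvertible)
    (v w z : E) :
    G u (christoffel G u v w) z
      = (1 / 2) * (fderiv ℝ G u v w z + fderiv ℝ G u w v z - fderiv ℝ G u z v w) := by
  rw [christoffel_apply, hi.self_apply_inverse, christoffelFirst_apply]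

theorem contDiffAt_christoffelFirst {G : E → E →L[ℝ] E →L[ℝ] ℝ} {u : E}
    (hG : ContDiffAt ℝ ∞ G u) : ContDiffAt ℝ ∞ (christoffelFirst G) u := by
  have hD : ContDiffAt ℝ ∞ (fderiv ℝ G) u := hG.fderiv_right (by simp)
  have hflip : ContDiffAt ℝ ∞ (fun u => (fderiv ℝ G u).flip) u :=
    (ContinuousLinearMap.flipₗᵢ ℝ E E (E →L[ℝ] ℝ)).toContinuousLinearEquiv.contDiff.comp_contDiffAt
      _ hD
  unfold christoffelFirst
  exact ((hD.add hflip).sub (contDiffAt_const.clm_comp hflip)).const_smul (1 / 2 : ℝ)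

theorem contDiffAt_christoffel [CompleteSpace E] {G : E → E →L[ℝ] E →L[ℝ] ℝ} {u : E}
    (hG : ContDiffAt ℝ ∞ G u) (hi : (G u).IsInvertible) :
    ContDiffAt ℝ ∞ (christoffel G) u := by
  have hinv : ContDiffAt ℝ ∞ (fun u => (G u).inverse) u := by
    obtain ⟨e, he⟩ := hi
    have := contDiffAt_map_inverse (n := ∞) e
    rw [he] at this
    exact this.comp u hG
  unfold christoffel
  exact ((ContinuousLinearMap.compL ℝ E (E →L[ℝ] ℝ) E).contDiff.comp_contDiffAt _ hinv).clm_comp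
    (contDiffAt_christoffelFirst hG)

theorem christoffel_symm {G : E → E →L[ℝ] E →L[ℝ] ℝ} {u : E} (hd : DifferentiableAt ℝ G u)
    (hs : ∀ᶠ y in 𝓝 u, ∀ v w, G y v w = G y w v) (v w : E) :
    christoffel G u v w = christoffel G u w v := by
  have key : ∀ X, fderiv ℝ G u X v w = fderiv ℝ G u X w v := by
    intro X
    have h1 := hasFDerivAt_apply_apply hd.hasFDerivAt v w
    have h2 := hasFDerivAt_apply_apply hd.hasFDerivAt w v
    have h3 := h2.congr_of_eventuallyEq (hs.mono fun y hy => hy v w)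
    exact congrArg (fun T => T X) (h1.unique h3)
  rw [christoffel_apply, christoffel_apply]
  congr 1
  ext z
  rw [christoffelFirst_apply, christoffelFirst_apply, key z]
  ring

theorem christoffel_congr {G G' : E → E →L[ℝ] E →L[ℝ] ℝ} {u : E} (h : G =ᶠ[𝓝 u] G') :
    christoffel G u = christoffel G' u := by
  unfold christoffel christoffelFirst
  rw [h.fderiv_eq, h.eq_of_nhds]

theorem ricciLocal_congr {G G' : E → E →L[ℝ] E →L[ℝ] ℝ} {u : E} (h : G =ᶠ[𝓝 u] G') (v w : E) :
    ricciLocal G u v w = ricciLocal G' u v w := by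
  have h' : christoffel G =ᶠ[𝓝 u] christoffel G' :=
    h.eventuallyEq_nhds.mono fun _ hy => christoffel_congr hy
  unfold ricciLocal curvatureOp
  rw [h'.fderiv_eq, h'.eq_of_nhds]

theorem hessLocal_congr {G G' : E → E →L[ℝ] E →L[ℝ] ℝ} {h h' : E → ℝ} {u : E}
    (hG : G =ᶠ[𝓝 u] G') (hh : h =ᶠ[𝓝 u] h') (v w : E) :
    hessLocal G h u v w = hessLocal G' h' u v w := by
  unfold hessLocal
  rw [hh.fderiv.fderiv_eq, hh.fderiv_eq, christoffel_congr hG]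

end LocalCalculus

/-! ### Traces on a product space. -/

section Trace

variable {V W : Type*} [AddCommGroup V] [Module ℝ V] [FiniteDimensional ℝ V]
  [AddCommGroup W] [Module ℝ W] [FiniteDimensional ℝ W]

/-- The trace of an endomorphism of a product is the sum of the traces of its diagonal blocks. -/
theorem trace_prod_blocks (T : V × W →ₗ[ℝ] V × W) :
    LinearMap.trace ℝ (V × W) T
      = LinearMap.trace ℝ V (LinearMap.fst ℝ V W ∘ₗ T ∘ₗ LinearMap.inl ℝ V W)
        + LinearMap.trace ℝ W (LinearMap.snd ℝ V W ∘ₗ T ∘ₗ LinearMap.inr ℝ V W) := by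
  have h : T = (T ∘ₗ LinearMap.inl ℝ V W) ∘ₗ LinearMap.fst ℝ V W
      + (T ∘ₗ LinearMap.inr ℝ V W) ∘ₗ LinearMap.snd ℝ V W := by
    refine LinearMap.ext fun x => ?_
    simp only [LinearMap.add_apply, LinearMap.comp_apply, ← map_add]
    simp
  conv_lhs => rw [h, map_add,
    LinearMap.trace_comp_comm' (LinearMap.fst ℝ V W) (T ∘ₗ LinearMap.inl ℝ V W),
    LinearMap.trace_comp_comm' (LinearMap.snd ℝ V W) (T ∘ₗ LinearMap.inr ℝ V W)]

end Trace

/-! ### First derivatives and Christoffel symbols of the warped metric. -/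

section PowerWarped

variable {E₁ E₂ : Type*} [NormedAddCommGroup E₁] [NormedSpace ℝ E₁]
  [NormedAddCommGroup E₂] [NormedSpace ℝ E₂]

/-- `f` is at `x` a power of an affine function `s`, to first order: `df = -(p / s) f α`. -/
abbrev HasPowerFDerivAt (α : E₁ →L[ℝ] ℝ) (s f : E₁ → ℝ) (p : ℝ) (x : E₁) : Prop :=
  HasFDerivAt f (-(p * (s x)⁻¹ * f x) • α) x

/-- The metric `φ⁻² η + f² g_F`. -/
abbrev powerMetric (η : E₁ →L[ℝ] E₁ →L[ℝ] ℝ) (φ f : E₁ → ℝ) (GF : E₂ → E₂ →L[ℝ] E₂ →L[ℝ] ℝ) :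
    E₁ × E₂ → (E₁ × E₂) →L[ℝ] (E₁ × E₂) →L[ℝ] ℝ :=
  warped (fun x => (1 / φ x ^ 2) • η) f GF

/-- Pull-back of bilinear forms, as a continuous linear map. -/
def pullL (E E' : Type*) [NormedAddCommGroup E] [NormedSpace ℝ E] [NormedAddCommGroup E']
    [NormedSpace ℝ E'] (p : E' →L[ℝ] E) :
    (E →L[ℝ] E →L[ℝ] ℝ) →L[ℝ] (E' →L[ℝ] E' →L[ℝ] ℝ) :=
  (ContinuousLinearMap.compL ℝ E' (E →L[ℝ] ℝ) (E' →L[ℝ] ℝ)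
      ((ContinuousLinearMap.compL ℝ E' E ℝ).flip p)).comp
    ((ContinuousLinearMap.compL ℝ E' E (E →L[ℝ] ℝ)).flip p)

theorem pullL_apply {E E' : Type*} [NormedAddCommGroup E] [NormedSpace ℝ E] [NormedAddCommGroup E']
    [NormedSpace ℝ E'] (p : E' →L[ℝ] E) (B : E →L[ℝ] E →L[ℝ] ℝ) :
    pullL E E' p B = B.bilinearComp p p := by
  ext v w
  simp [pullL]

theorem powerMetric_eq (η : E₁ →L[ℝ] E₁ →L[ℝ] ℝ) (φ f : E₁ → ℝ)
    (GF : E₂ → E₂ →L[ℝ] E₂ →L[ℝ] ℝ) :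
    powerMetric η φ f GF = fun u =>
      (1 / φ u.1 ^ 2) • pullL E₁ (E₁ × E₂) (ContinuousLinearMap.fst ℝ E₁ E₂) η
        + (f u.1 ^ 2) • pullL E₂ (E₁ × E₂) (ContinuousLinearMap.snd ℝ E₁ E₂) (GF u.2) := by
  funext u
  ext v w <;> simp [pullL_apply, warped]

theorem hasFDerivAt_powerMetric_apply {η : E₁ →L[ℝ] E₁ →L[ℝ] ℝ} {α : E₁ →L[ℝ] ℝ} {s φ f : E₁ → ℝ}
    {k : ℝ} {GF : E₂ → E₂ →L[ℝ] E₂ →L[ℝ] ℝ} {x : E₁} {y : E₂}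
    (hφ : HasPowerFDerivAt α s φ k x) (hφ0 : φ x ≠ 0) (hf : HasPowerFDerivAt α s f 1 x)
    (hG : DifferentiableAt ℝ GF y) (X v w : E₁ × E₂) :
    fderiv ℝ (powerMetric η φ f GF) (x, y) X v w
      = 2 * k * (s x)⁻¹ * (1 / φ x ^ 2) * α X.1 * η v.1 w.1
        + f x ^ 2 * (fderiv ℝ GF y X.2 v.2 w.2 - 2 * (s x)⁻¹ * α X.1 * GF y v.2 w.2) := by
  have hφ' : HasFDerivAt (fun u : E₁ × E₂ => φ u.1) _ (x, y) := 
    HasFDerivAt.comp (x, y) (f := Prod.fst) hφ hasFDerivAt_fst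
  have hf' : HasFDerivAt (fun u : E₁ × E₂ => f u.1) _ (x, y) := 
    HasFDerivAt.comp (x, y) (f := Prod.fst) hf hasFDerivAt_fst
  have hG' : HasFDerivAt (fun u : E₁ × E₂ => GF u.2) _ (x, y) := 
    HasFDerivAt.comp (x, y) (f := Prod.snd) hG.hasFDerivAt hasFDerivAt_snd
  have hA : HasFDerivAt (fun u : E₁ × E₂ => 1 / φ u.1 ^ 2)
      ((2 * k * (s x)⁻¹ * (1 / φ x ^ 2)) • α.comp (ContinuousLinearMap.fst ℝ E₁ E₂)) (x, y) := by
    have h := ((hasDerivAt_zpow (-2) (φ x) (Or.inl hφ0)).comp_hasFDerivAt (x, y) hφ')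
    refine HasFDerivAt.congr_of_eventuallyEq (h.congr_fderiv ?_) (.of_forall fun u => ?_)
    · ext X <;> simp
      field_simp
    · simp [zpow_neg]
  have hB : HasFDerivAt (fun u : E₁ × E₂ => f u.1 ^ 2)
      ((-2 * (s x)⁻¹ * f x ^ 2) • α.comp (ContinuousLinearMap.fst ℝ E₁ E₂)) (x, y) := by
    refine (hf'.pow 2).congr_fderiv ?_
    ext X <;> simp
    ring
  have hC : HasFDerivAt (fun u : E₁ × E₂ =>
      pullL E₂ (E₁ × E₂) (ContinuousLinearMap.snd ℝ E₁ E₂) (GF u.2)) _ (x, y) :=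
    (pullL E₂ (E₁ × E₂) (ContinuousLinearMap.snd ℝ E₁ E₂)).hasFDerivAt.comp (x, y) hG'
  have hP := (hA.smul_const (pullL E₁ (E₁ × E₂) (ContinuousLinearMap.fst ℝ E₁ E₂) η)).fun_add
    (hB.fun_smul hC)
  rw [powerMetric_eq, hP.fderiv]
  simp [pullL_apply]
  ring

theorem isInvertible_powerMetric [FiniteDimensional ℝ E₁] [FiniteDimensional ℝ E₂]
    {η : E₁ →L[ℝ] E₁ →L[ℝ] ℝ} {φ f : E₁ → ℝ} {GF : E₂ → E₂ →L[ℝ] E₂ →L[ℝ] ℝ} {u : E₁ × E₂}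
    (hη : η.IsInvertible) (hφ0 : φ u.1 ≠ 0) (hf0 : f u.1 ≠ 0) (hG : (GF u.2).IsInvertible) :
    (powerMetric η φ f GF u).IsInvertible := by
  refine isInvertible_of_nondegenerate _ fun v hv => ?_
  have h1 : v.1 = 0 := by
    refine hη.injective ?_
    ext w
    have := hv (w, 0)
    simpa [warped_apply, hφ0] using this
  have h2 : v.2 = 0 := by
    refine hG.injective ?_
    ext w
    have := hv (0, w)
    simpa [warped_apply, hf0] using this
  exact Prod.ext h1 h2

/-- The first summand is the usual conformal change of a constant form, with `d log φ = -(k/s) α`.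
The term along `n`, the `η`-gradient of `α`, and the mixed terms come from the warping, with `d log
f = -(1/s) α`. -/
theorem christoffel_powerMetric [FiniteDimensional ℝ E₁] [FiniteDimensional ℝ E₂]
    {η : E₁ →L[ℝ] E₁ →L[ℝ] ℝ} {α : E₁ →L[ℝ] ℝ} {n : E₁} {s φ f : E₁ → ℝ}
    {k : ℝ} {GF : E₂ → E₂ →L[ℝ] E₂ →L[ℝ] ℝ} {u : E₁ × E₂}
    (hη : η.IsInvertible) (hn : η n = α)
    (hφ : HasPowerFDerivAt α s φ k u.1) (hφ0 : φ u.1 ≠ 0)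
    (hf : HasPowerFDerivAt α s f 1 u.1) (hf0 : f u.1 ≠ 0)
    (hG : DifferentiableAt ℝ GF u.2) (hGi : (GF u.2).IsInvertible) (v w : E₁ × E₂) :
    christoffel (powerMetric η φ f GF) u v w
      = ((k * (s u.1)⁻¹) • (α v.1 • w.1 + α w.1 • v.1 - η v.1 w.1 • n)
            + ((s u.1)⁻¹ * φ u.1 ^ 2 * f u.1 ^ 2 * GF u.2 v.2 w.2) • n,
          christoffel GF u.2 v.2 w.2 - (s u.1)⁻¹ • (α v.1 • w.2 + α w.1 • v.2)) := by
  obtain ⟨x, y⟩ := u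
  refine christoffel_eq (isInvertible_powerMetric hη hφ0 hf0 hGi) fun z => ?_
  simp only [hasFDerivAt_powerMetric_apply hφ hφ0 hf hG, warped_apply]
  simp only [map_add, map_sub, map_smul, add_apply, sub_apply,
    smul_apply, apply_christoffel hGi, hn, smul_eq_mul]
  field_simp
  ring

theorem contDiffAt_powerMetric {η : E₁ →L[ℝ] E₁ →L[ℝ] ℝ} {φ f : E₁ → ℝ}
    {GF : E₂ → E₂ →L[ℝ] E₂ →L[ℝ] ℝ} {u : E₁ × E₂} (hφ : ContDiffAt ℝ ∞ φ u.1) (hφ0 : φ u.1 ≠ 0)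
    (hf : ContDiffAt ℝ ∞ f u.1) (hG : ContDiffAt ℝ ∞ GF u.2) :
    ContDiffAt ℝ ∞ (powerMetric η φ f GF) u := by
  have hφ' : ContDiffAt ℝ ∞ (fun u : E₁ × E₂ => φ u.1) u := hφ.comp u contDiffAt_fst
  have hf' : ContDiffAt ℝ ∞ (fun u : E₁ × E₂ => f u.1) u := hf.comp u contDiffAt_fst
  have hG' : ContDiffAt ℝ ∞ (fun u : E₁ × E₂ => GF u.2) u := hG.comp u contDiffAt_snd
  rw [powerMetric_eq]
  exact ((contDiffAt_const.div (hφ'.pow 2) (pow_ne_zero 2 hφ0)).smul contDiffAt_const).add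
    ((hf'.pow 2).smul ((pullL E₂ (E₁ × E₂) _).contDiff.comp_contDiffAt _ hG'))

end PowerWarped

/-! ### Ricci tensor and Hessian of the warped metric. -/

section PowerWarpedCurvature

variable {E₁ E₂ : Type*} [NormedAddCommGroup E₁] [NormedSpace ℝ E₁]
  [NormedAddCommGroup E₂] [NormedSpace ℝ E₂]

/-- Data for the warped product metric `φ⁻² η + f² g_F` near `u`, with `φ` and `f` powers of the
affine function `s`. -/
structure PowerData (η : E₁ →L[ℝ] E₁ →L[ℝ] ℝ) (α : E₁ →L[ℝ] ℝ) (n : E₁) (s φ f : E₁ → ℝ)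
    (δ k : ℝ) (GF : E₂ → E₂ →L[ℝ] E₂ →L[ℝ] ℝ) (u : E₁ × E₂) : Prop where
  inv : η.IsInvertible
  symm : ∀ v w, η v w = η w v
  grad : η n = α
  affine : HasFDerivAt s (δ • α) u.1
  ne : s u.1 ≠ 0
  smooth_φ : ContDiffAt ℝ ∞ φ u.1
  smooth_f : ContDiffAt ℝ ∞ f u.1
  deriv_φ : ∀ᶠ x in 𝓝 u.1, φ x ≠ 0 ∧ HasPowerFDerivAt α s φ k x
  deriv_f : ∀ᶠ x in 𝓝 u.1, f x ≠ 0 ∧ HasPowerFDerivAt α s f 1 x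
  smooth_F : ContDiffAt ℝ ∞ GF u.2
  inv_F : (GF u.2).IsInvertible
  symm_F : ∀ᶠ y in 𝓝 u.2, ∀ v w, GF y v w = GF y w v

variable {η : E₁ →L[ℝ] E₁ →L[ℝ] ℝ} {α : E₁ →L[ℝ] ℝ} {n : E₁} {s φ f : E₁ → ℝ}
  {δ k : ℝ} {GF : E₂ → E₂ →L[ℝ] E₂ →L[ℝ] ℝ} {u : E₁ × E₂}

namespace PowerData

theorem eventually_christoffel [FiniteDimensional ℝ E₁] [FiniteDimensional ℝ E₂]
    (D : PowerData η α n s φ f δ k GF u) :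
    ∀ᶠ u' in 𝓝 u, ∀ v w, christoffel (powerMetric η φ f GF) u' v w
      = ((k * (s u'.1)⁻¹) • (α v.1 • w.1 + α w.1 • v.1 - η v.1 w.1 • n)
            + ((s u'.1)⁻¹ * φ u'.1 ^ 2 * f u'.1 ^ 2 * GF u'.2 v.2 w.2) • n,
          christoffel GF u'.2 v.2 w.2 - (s u'.1)⁻¹ • (α v.1 • w.2 + α w.1 • v.2)) := by
  -- Being `C^∞` at a point need not persist on a neighbourhood, but each finite order does; order 1
  -- suffices here.
  have h1 := (D.smooth_F.of_le (m := 1) (by simp)).eventually (by simp)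
  have h2 := eventually_isInvertible D.smooth_F.continuousAt D.inv_F
  filter_upwards [continuous_fst.continuousAt.eventually D.deriv_φ,
    continuous_fst.continuousAt.eventually D.deriv_f,
    continuous_snd.continuousAt.eventually h1,
    continuous_snd.continuousAt.eventually h2] with u' hφ hf hG hGi v w
  exact christoffel_powerMetric D.inv D.grad hφ.2 hφ.1 hf.2 hf.1
    (hG.differentiableAt (by simp)) hGi v w

/-- The closed form holds on a neighbourhood of `u`, so it may be differentiated there with `v` and
`w` fixed; smoothness of the Christoffel map lets evaluation at `v`, `w` commute with the
derivative. -/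
theorem fderiv_christoffel [FiniteDimensional ℝ E₁] [FiniteDimensional ℝ E₂]
    (D : PowerData η α n s φ f δ k GF u) (X v w : E₁ × E₂) :
    fderiv ℝ (christoffel (powerMetric η φ f GF)) u X v w
      = ((-(k * δ * (s u.1)⁻¹ ^ 2) * α X.1) • (α v.1 • w.1 + α w.1 • v.1 - η v.1 w.1 • n)
            + ((s u.1)⁻¹ * φ u.1 ^ 2 * f u.1 ^ 2 * (fderiv ℝ GF u.2 X.2 v.2 w.2
              - (2 * k + 2 + δ) * (s u.1)⁻¹ * α X.1 * GF u.2 v.2 w.2)) • n,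
          fderiv ℝ (christoffel GF) u.2 X.2 v.2 w.2
            + (δ * (s u.1)⁻¹ ^ 2 * α X.1) • (α v.1 • w.2 + α w.1 • v.2)) := by
  obtain ⟨hφ0, hφ⟩ := D.deriv_φ.self_of_nhds
  obtain ⟨hf0, hf⟩ := D.deriv_f.self_of_nhds
  have hinv : (powerMetric η φ f GF u).IsInvertible :=
    isInvertible_powerMetric D.inv hφ0 hf0 D.inv_F
  have hsm := contDiffAt_christoffel
    (contDiffAt_powerMetric (η := η) D.smooth_φ hφ0 D.smooth_f D.smooth_F) hinv
  have hd := hasFDerivAt_apply_apply (hsm.differentiableAt (by simp)).hasFDerivAt v w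
  have hφ' : HasFDerivAt (fun u : E₁ × E₂ => φ u.1) _ u :=
    HasFDerivAt.comp u (f := Prod.fst) hφ hasFDerivAt_fst
  have hf' : HasFDerivAt (fun u : E₁ × E₂ => f u.1) _ u :=
    HasFDerivAt.comp u (f := Prod.fst) hf hasFDerivAt_fst
  have hs' : HasFDerivAt (fun u : E₁ × E₂ => s u.1) _ u :=
    HasFDerivAt.comp u (f := Prod.fst) D.affine hasFDerivAt_fst
  have hS : HasFDerivAt (fun u : E₁ × E₂ => (s u.1)⁻¹)
      ((-(δ * (s u.1)⁻¹ ^ 2)) • α.comp (ContinuousLinearMap.fst ℝ E₁ E₂)) u := by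
    refine ((hasDerivAt_inv D.ne).comp_hasFDerivAt u hs').congr_fderiv ?_
    ext X <;> simp
    ring
  -- Logarithmic derivatives add: `s⁻¹`, `φ²` and `f²` contribute `-δ/s`, `-2k/s` and `-2/s`.
  have hP : HasFDerivAt (fun u : E₁ × E₂ => (s u.1)⁻¹ * φ u.1 ^ 2 * f u.1 ^ 2)
      ((-((s u.1)⁻¹ * φ u.1 ^ 2 * f u.1 ^ 2 * (2 * k + 2 + δ) * (s u.1)⁻¹)) •
        α.comp (ContinuousLinearMap.fst ℝ E₁ E₂)) u := by
    refine ((hS.mul (hφ'.pow 2)).mul (hf'.pow 2)).congr_fderiv ?_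
    ext X <;> simp
    ring
  have hg : HasFDerivAt (fun u : E₁ × E₂ => GF u.2 v.2 w.2) _ u :=
    HasFDerivAt.comp u (f := Prod.snd) (hasFDerivAt_apply_apply
      (D.smooth_F.differentiableAt (by simp)).hasFDerivAt v.2 w.2) hasFDerivAt_snd
  have hΓ : HasFDerivAt (fun u : E₁ × E₂ => christoffel GF u.2 v.2 w.2) _ u :=
    HasFDerivAt.comp u (f := Prod.snd) (hasFDerivAt_apply_apply
      ((contDiffAt_christoffel D.smooth_F D.inv_F).differentiableAt (by simp)).hasFDerivAt
        v.2 w.2) hasFDerivAt_snd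
  have hE := (((hS.const_mul k).smul_const (α v.1 • w.1 + α w.1 • v.1 - η v.1 w.1 • n)).fun_add
    ((hP.fun_mul hg).smul_const n)).prodMk
      (hΓ.fun_sub (hS.smul_const (α v.1 • w.2 + α w.1 • v.2)))
  have := hd.unique (hE.congr_of_eventuallyEq (D.eventually_christoffel.mono fun u' h => h v w))
  have := congrArg (fun T => T X) this
  simp only [ContinuousLinearMap.flip_apply] at this
  rw [this]
  ext
  · simp
    module
  · simp
    module

theorem trace_base_block [FiniteDimensional ℝ E₁] [FiniteDimensional ℝ E₂]
    (D : PowerData η α n s φ f δ k GF u) (v w : E₁ × E₂) :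
    LinearMap.trace ℝ E₁ (LinearMap.fst ℝ E₁ E₂ ∘ₗ
        (curvatureOp (powerMetric η φ f GF) u v w : E₁ × E₂ →ₗ[ℝ] E₁ × E₂) ∘ₗ
        LinearMap.inl ℝ E₁ E₂)
      = (Module.finrank ℝ E₁ - 2) * (k ^ 2 + k * δ) * (s u.1)⁻¹ ^ 2 * α v.1 * α w.1
        + (k * δ - (Module.finrank ℝ E₁ - 2) * k ^ 2) * (s u.1)⁻¹ ^ 2 * η v.1 w.1 * α n
        + ((s u.1)⁻¹ * φ u.1 ^ 2 * f u.1 ^ 2 * GF u.2 v.2 w.2) * α n * (s u.1)⁻¹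
          * (Module.finrank ℝ E₁ * k - (2 * k + 1 + δ)) := by
  have hn : ∀ X, η X n = α X := fun X => by rw [D.symm, D.grad]
  have hc := D.eventually_christoffel.self_of_nhds
  generalize hS : (s u.1)⁻¹ = S at hc
  generalize hP : S * φ u.1 ^ 2 * f u.1 ^ 2 = P at hc
  generalize hg : GF u.2 v.2 w.2 = g
  -- Written as rank-one maps plus a scalar, the block has a trace that can be read off: `X ↦ λ(X)
  -- y` has trace `λ(y)`, and the identity has trace the dimension.
  have hD : LinearMap.fst ℝ E₁ E₂ ∘ₗ
        (curvatureOp (powerMetric η φ f GF) u v w : E₁ × E₂ →ₗ[ℝ] E₁ × E₂) ∘ₗ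
        LinearMap.inl ℝ E₁ E₂
      = (α : E₁ →ₗ[ℝ] ℝ).smulRight
          ((-(k * δ * S ^ 2) * α w.1 - k ^ 2 * S ^ 2 * α w.1) • v.1
            + (k * δ * S ^ 2 * η v.1 w.1 + k ^ 2 * S ^ 2 * η v.1 w.1
              - P * g * (2 * k + 1 + δ) * S) • n)
        + (η w.1 : E₁ →ₗ[ℝ] ℝ).smulRight
          ((-(k * δ * S ^ 2) * α v.1 - k ^ 2 * S ^ 2 * α v.1) • n + (k ^ 2 * S ^ 2 * α n) • v.1)
        + (k * δ * S ^ 2 * α v.1 * α w.1 + k ^ 2 * S ^ 2 * α v.1 * α w.1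
            - k ^ 2 * S ^ 2 * η v.1 w.1 * α n + k * S * P * g * α n) • LinearMap.id := by
    refine LinearMap.ext fun X => ?_
    simp only [LinearMap.comp_apply, LinearMap.inl_apply, ContinuousLinearMap.coe_coe,
      curvatureOp_apply, D.fderiv_christoffel, hc, LinearMap.fst_apply, LinearMap.add_apply,
      LinearMap.smul_apply, LinearMap.smulRight_apply, LinearMap.id_apply, hS, hP, hg]
    simp [D.symm w.1 X, D.symm X v.1, hn, hg]
    module
  rw [hD]
  simp only [map_add, map_smul, LinearMap.trace_smulRight, LinearMap.trace_id]
  simp [D.symm w.1 v.1, hn]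
  ring

theorem trace_fibre_block [FiniteDimensional ℝ E₁] [FiniteDimensional ℝ E₂]
    (D : PowerData η α n s φ f δ k GF u) (v w : E₁ × E₂) :
    LinearMap.trace ℝ E₂ (LinearMap.snd ℝ E₁ E₂ ∘ₗ
        (curvatureOp (powerMetric η φ f GF) u v w : E₁ × E₂ →ₗ[ℝ] E₁ × E₂) ∘ₗ
        LinearMap.inr ℝ E₁ E₂)
      = ricciLocal GF u.2 v.2 w.2
        - Module.finrank ℝ E₂ * (s u.1)⁻¹ ^ 2 *
          ((δ + 2 * k + 1) * α v.1 * α w.1 - k * η v.1 w.1 * α n)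
        + ((s u.1)⁻¹ * φ u.1 ^ 2 * f u.1 ^ 2 * GF u.2 v.2 w.2) * α n * (s u.1)⁻¹
          * (1 - Module.finrank ℝ E₂) := by
  have hc := D.eventually_christoffel.self_of_nhds
  have hΓ := christoffel_symm (D.smooth_F.differentiableAt (by simp)) D.symm_F
  have hsym := D.symm_F.self_of_nhds
  generalize hS : (s u.1)⁻¹ = S at hc
  generalize hP : S * φ u.1 ^ 2 * f u.1 ^ 2 = P at hc
  generalize hg : GF u.2 v.2 w.2 = g
  -- Symmetry of `g_F` and of its Christoffel symbols brings the block to this form: fibre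
  -- curvature, one rank-one map and a scalar.
  have hD : LinearMap.snd ℝ E₁ E₂ ∘ₗ
        (curvatureOp (powerMetric η φ f GF) u v w : E₁ × E₂ →ₗ[ℝ] E₁ × E₂) ∘ₗ
        LinearMap.inr ℝ E₁ E₂
      = (curvatureOp GF u.2 v.2 w.2 : E₂ →ₗ[ℝ] E₂)
        + (GF u.2 w.2 : E₂ →ₗ[ℝ] ℝ).smulRight ((S * P * α n) • v.2)
        + (-(S ^ 2 * ((δ + 2 * k + 1) * α v.1 * α w.1 - k * η v.1 w.1 * α n))
            - S * P * g * α n) • LinearMap.id := by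
    refine LinearMap.ext fun X => ?_
    simp only [LinearMap.comp_apply, LinearMap.inr_apply, ContinuousLinearMap.coe_coe,
      curvatureOp_apply, D.fderiv_christoffel, hc, LinearMap.snd_apply, LinearMap.add_apply,
      LinearMap.smul_apply, LinearMap.smulRight_apply, LinearMap.id_apply, hS, hP, hg]
    simp [hsym w.2 X, hΓ v.2 X]
    module
  rw [hD]
  simp only [map_add, map_smul, LinearMap.trace_smulRight, LinearMap.trace_id]
  simp [hsym w.2 v.2, hg, ricciLocal]
  ring

/-- Since `dh = -(N/s) h α`, the second derivative is `N(N + δ) s⁻² h α ⊗ α`, and the connection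
term adds `(N/s) h α(Γ)`. -/
theorem hessLocal_eq [FiniteDimensional ℝ E₁] [FiniteDimensional ℝ E₂]
    (D : PowerData η α n s φ f δ k GF u) {h : E₁ → ℝ} {N : ℝ}
    (hh : ∀ᶠ x in 𝓝 u.1, HasPowerFDerivAt α s h N x) (v w : E₁ × E₂) :
    hessLocal (powerMetric η φ f GF) (fun u => h u.1) u v w
      = h u.1 * N * ((s u.1)⁻¹ ^ 2 * (δ + N + 2 * k) * α v.1 * α w.1
          - k * (s u.1)⁻¹ ^ 2 * η v.1 w.1 * α n
          + (s u.1)⁻¹ * ((s u.1)⁻¹ * φ u.1 ^ 2 * f u.1 ^ 2 * GF u.2 v.2 w.2) * α n) := by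
  have hh' : ∀ᶠ u' in 𝓝 u, HasFDerivAt (fun u : E₁ × E₂ => h u.1)
      ((-(N * (s u'.1)⁻¹ * h u'.1)) • α.comp (ContinuousLinearMap.fst ℝ E₁ E₂)) u' := by
    filter_upwards [continuous_fst.continuousAt.eventually hh] with u' hu'
    exact (HasFDerivAt.comp u' (f := Prod.fst) hu' hasFDerivAt_fst).congr_fderiv (by ext <;> simp)
  have h1 := hh'.self_of_nhds
  have hs' : HasFDerivAt (fun u : E₁ × E₂ => s u.1) _ u :=
    HasFDerivAt.comp u (f := Prod.fst) D.affine hasFDerivAt_fst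
  have hS : HasFDerivAt (fun u : E₁ × E₂ => (s u.1)⁻¹)
      ((-(δ * (s u.1)⁻¹ ^ 2)) • α.comp (ContinuousLinearMap.fst ℝ E₁ E₂)) u := by
    refine ((hasDerivAt_inv D.ne).comp_hasFDerivAt u hs').congr_fderiv ?_
    ext X <;> simp
    ring
  have h2 := ((hS.const_mul N).fun_mul h1).fun_neg.smul_const
    (α.comp (ContinuousLinearMap.fst ℝ E₁ E₂))
  have h3 : fderiv ℝ (fun u : E₁ × E₂ => h u.1) =ᶠ[𝓝 u] fun u' =>
      (-(N * (s u'.1)⁻¹ * h u'.1)) • α.comp (ContinuousLinearMap.fst ℝ E₁ E₂) :=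
    hh'.mono fun u' hu' => hu'.fderiv
  rw [hessLocal, h3.fderiv_eq, h2.fderiv, h1.fderiv, D.eventually_christoffel.self_of_nhds]
  simp
  ring

/-- The Ricci tensor of the warped product, minus the Hessian term, over a Ricci-flat fibre. -/
theorem quasiEinstein [FiniteDimensional ℝ E₁] [FiniteDimensional ℝ E₂]
    (D : PowerData η α n s φ f δ k GF u) {h : E₁ → ℝ} {N : ℝ}
    (hh : ∀ᶠ x in 𝓝 u.1, HasPowerFDerivAt α s h N x) (hh0 : h u.1 ≠ 0)
    (hR : ∀ v w, ricciLocal GF u.2 v w = 0)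
    (h₁ : δ + N = (Module.finrank ℝ E₁ - 2) * k - Module.finrank ℝ E₂)
    (h₂ : (Module.finrank ℝ E₁ - 2) * (k ^ 2 + k * δ)
      = Module.finrank ℝ E₂ * (δ + 2 * k + 1) + N * (δ + N + 2 * k)) (v w : E₁ × E₂) :
    ricciLocal (powerMetric η φ f GF) u v w
      - 1 / h u.1 * hessLocal (powerMetric η φ f GF) (fun u => h u.1) u v w = 0 := by
  have h3 : ∀ H : ℝ, 1 / h u.1 * (h u.1 * N * H) = N * H := fun H => by field_simp
  rw [ricciLocal, trace_prod_blocks, D.trace_base_block, D.trace_fibre_block, hR,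
    D.hessLocal_eq hh, h3]
  generalize (s u.1)⁻¹ * φ u.1 ^ 2 * f u.1 ^ 2 * GF u.2 v.2 w.2 = P
  -- `h₂` cancels the `α ⊗ α` part; `h₁` cancels both the `η` part and the `g_F` part, collected in
  -- `P`.
  linear_combination (s u.1)⁻¹ ^ 2 * α v.1 * α w.1 * h₂
    + (k * (s u.1)⁻¹ ^ 2 * η v.1 w.1 * α n - P * α n * (s u.1)⁻¹) * h₁

end PowerData
end PowerWarpedCurvature

/-! ### Warped products in product charts. -/

section Charts

variable {E₁ E : Type*} [NormedAddCommGroup E₁] [NormedSpace ℝ E₁]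
  [NormedAddCommGroup E] [NormedSpace ℝ E]
  {H : Type*} [TopologicalSpace H] {I : ModelWithCorners ℝ E H}
  {M : Type*} [TopologicalSpace M] [ChartedSpace H M]

theorem extChartAt_prod_model_apply (p z : E₁ × M) :
    extChartAt (𝓘(ℝ, E₁).prod I) p z = (z.1, extChartAt I p.2 z.2) := by
  rw [extChartAt_prod, extChartAt_model_space_eq_id]
  rfl

theorem extChartAt_prod_model_symm_apply (p : E₁ × M) (u : E₁ × E) :
    (extChartAt (𝓘(ℝ, E₁).prod I) p).symm u = (u.1, (extChartAt I p.2).symm u.2) := by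
  rw [extChartAt_prod, extChartAt_model_space_eq_id]
  rfl

variable [I.Boundaryless] [IsManifold I ∞ M]

theorem hasFDerivAt_chartDeriv (y : M) {u : E} (hu : u ∈ (extChartAt I y).target) :
    HasFDerivAt (extChartAt I ((extChartAt I y).symm u) ∘ (extChartAt I y).symm)
      (chartDeriv I y u) u := by
  have h := contDiffWithinAt_ext_coord_change (I := I) (n := ∞) ((extChartAt I y).symm u) y
    (y := u) (by
      rw [PartialEquiv.trans_source, PartialEquiv.symm_source]
      exact ⟨hu, mem_extChartAt_source (I := I) _⟩)
  rw [I.range_eq_univ, contDiffWithinAt_univ] at h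
  exact (h.differentiableAt (by simp)).hasFDerivAt

/-- The vector space factor has the identity as its only preferred chart, so a transition map of the
product acts on the second factor alone. -/
theorem chartDeriv_prod (p : E₁ × M) {u : E₁ × E} (hu : u.2 ∈ (extChartAt I p.2).target) :
    chartDeriv (𝓘(ℝ, E₁).prod I) p u
      = (ContinuousLinearMap.id ℝ E₁).prodMap (chartDeriv I p.2 u.2) := by
  have h := (hasFDerivAt_id (𝕜 := ℝ) u.1).prodMap u (hasFDerivAt_chartDeriv p.2 hu)
  refine (h.congr_of_eventuallyEq (.of_forall fun z => ?_)).fderiv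
  simp only [Function.comp_apply, extChartAt_prod_model_apply, extChartAt_prod_model_symm_apply]
  rfl

theorem inChart_warped (gB : E₁ → E₁ →L[ℝ] E₁ →L[ℝ] ℝ) (f : E₁ → ℝ) (gF : M → E →L[ℝ] E →L[ℝ] ℝ)
    (p : E₁ × M) {u : E₁ × E} (hu : u.2 ∈ (extChartAt I p.2).target) :
    inChart (𝓘(ℝ, E₁).prod I) (warped gB f gF) p u = warped gB f (inChart I gF p.2) u := by
  refine ContinuousLinearMap.ext fun v => ContinuousLinearMap.ext fun w => ?_
  rw [inChart_apply, chartDeriv_prod p hu, warped_apply, warped_apply, inChart_apply,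
    extChartAt_prod_model_symm_apply]
  rfl

theorem eventually_inChart_warped (gB : E₁ → E₁ →L[ℝ] E₁ →L[ℝ] ℝ) (f : E₁ → ℝ)
    (gF : M → E →L[ℝ] E →L[ℝ] ℝ) (p : E₁ × M) :
    inChart (𝓘(ℝ, E₁).prod I) (warped gB f gF) p
      =ᶠ[𝓝 (extChartAt (𝓘(ℝ, E₁).prod I) p p)] warped gB f (inChart I gF p.2) := by
  rw [extChartAt_prod_model_apply]
  have : ∀ᶠ u : E₁ × E in 𝓝 (p.1, extChartAt I p.2 p.2), u.2 ∈ (extChartAt I p.2).target :=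
    continuous_snd.continuousAt.eventually (extChartAt_target_mem_nhds (I := I) p.2)
  exact this.mono fun u hu => inChart_warped gB f gF p hu

theorem ricci_warped (gB : E₁ → E₁ →L[ℝ] E₁ →L[ℝ] ℝ) (f : E₁ → ℝ)
    (gF : M → E →L[ℝ] E →L[ℝ] ℝ) (p : E₁ × M) (v w : E₁ × E) :
    ricci (𝓘(ℝ, E₁).prod I) (warped gB f gF) p v w
      = ricciLocal (warped gB f (inChart I gF p.2)) (p.1, extChartAt I p.2 p.2) v w := by
  rw [ricci, ricciLocal_congr (eventually_inChart_warped gB f gF p), extChartAt_prod_model_apply]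

theorem hess_warped (gB : E₁ → E₁ →L[ℝ] E₁ →L[ℝ] ℝ) (f : E₁ → ℝ)
    (gF : M → E →L[ℝ] E →L[ℝ] ℝ) (h : E₁ → ℝ) (p : E₁ × M) (v w : E₁ × E) :
    hess (𝓘(ℝ, E₁).prod I) (warped gB f gF) (fun p => h p.1) p v w
      = hessLocal (warped gB f (inChart I gF p.2)) (fun u => h u.1)
          (p.1, extChartAt I p.2 p.2) v w := by
  rw [hess, hessLocal_congr (eventually_inChart_warped gB f gF p)
    (h' := fun u : E₁ × E => h u.1), extChartAt_prod_model_apply]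
  exact .of_forall fun u => by
    rw [Function.comp_apply, extChartAt_prod_model_symm_apply]

/-- The warped product of a conformally constant metric and a semi-Riemannian manifold is
semi-Riemannian. -/
theorem isSemiRiemannianOn_warped {η : E₁ →L[ℝ] E₁ →L[ℝ] ℝ} {φ f : E₁ → ℝ} {U : Set E₁}
    {gF : M → E →L[ℝ] E →L[ℝ] ℝ} (hU : IsOpen U) (hη : η.IsInvertible)
    (hηs : ∀ v w, η v w = η w v) (hφ : ContDiffOn ℝ ∞ φ U) (hf : ContDiffOn ℝ ∞ f U)
    (hφ0 : ∀ x ∈ U, φ x ≠ 0) (hf0 : ∀ x ∈ U, f x ≠ 0) (hF : IsSemiRiemannianOn I gF Set.univ) :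
    IsSemiRiemannianOn (𝓘(ℝ, E₁).prod I) (warped (fun x => (1 / φ x ^ 2) • η) f gF)
      (U ×ˢ Set.univ) where
  isOpen := hU.prod isOpen_univ
  symm p _ v w := by
    simp only [warped_apply, smul_apply]
    rw [hηs, hF.symm p.2 trivial]
  nondegenerate p hp v hv := by
    have hp0 := hφ0 p.1 hp.1
    have hq0 := hf0 p.1 hp.1
    have h1 : v.1 = 0 := by
      refine hη.injective ?_
      ext w
      have := hv (w, 0)
      simpa [warped_apply, hp0] using this
    have h2 : v.2 = 0 := by
      refine hF.nondegenerate p.2 trivial _ fun w => ?_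
      have := hv (0, w)
      simpa [warped_apply, hq0] using this
    exact Prod.ext h1 h2
  constIndex p hp q hq := by
    obtain ⟨L, hL⟩ := hF.constIndex p.2 trivial q.2 trivial
    have h1 := hφ0 p.1 hp.1
    have h2 := hφ0 q.1 hq.1
    have h3 := hf0 p.1 hp.1
    have h4 := hf0 q.1 hq.1
    -- The two scalings compensate for the change of the factors `φ⁻²` and `f²` between `p` and `q`;
    -- `L` is an isometry of the fibre tangent spaces.
    refine ⟨(LinearEquiv.smulOfNeZero ℝ E₁ (φ q.1 / φ p.1) (div_ne_zero h2 h1)).prodCongr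
      (L.trans (LinearEquiv.smulOfNeZero ℝ E (f p.1 / f q.1) (div_ne_zero h3 h4))), fun v w => ?_⟩
    simp [warped_apply, hL]
    field_simp
  smooth p hp := by
    refine ContDiffAt.congr_of_eventuallyEq ?_ (eventually_inChart_warped _ f gF p)
    rw [extChartAt_prod_model_apply]
    have hn := hU.mem_nhds hp.1
    exact contDiffAt_powerMetric (hφ.contDiffAt hn) (hφ0 _ hp.1) (hf.contDiffAt hn)
      (hF.smooth p.2 trivial)

end Charts

/-! ### Powers of an affine function. -/

section Power

variable {E₁ : Type*} [NormedAddCommGroup E₁] [NormedSpace ℝ E₁]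

theorem contDiffOn_const_mul_rpow {s f : E₁ → ℝ} {U : Set E₁} (hs : ContDiff ℝ ∞ s)
    (hpos : ∀ x ∈ U, 0 < s x) {c p : ℝ} (hf : ∀ x ∈ U, f x = c * s x ^ p) :
    ContDiffOn ℝ ∞ f U :=
  ContDiffOn.congr (contDiffOn_const.mul (hs.contDiffOn.rpow_const_of_ne
    fun x hx => (hpos x hx).ne')) hf

theorem hasPowerFDerivAt_const_mul_rpow {α : E₁ →L[ℝ] ℝ} {s f : E₁ → ℝ} {U : Set E₁}
    (hU : IsOpen U) {δ : ℝ} (hδ : δ ≠ 0) (hs : ∀ x, HasFDerivAt s (δ • α) x)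
    (hpos : ∀ x ∈ U, 0 < s x) {c p : ℝ} (hf : ∀ x ∈ U, f x = c * s x ^ (-(p / δ)))
    {x : E₁} (hx : x ∈ U) : HasPowerFDerivAt α s f p x := by
  have h := ((hs x).rpow_const (p := -(p / δ)) (Or.inl (hpos x hx).ne')).const_mul c
  refine (h.congr_of_eventuallyEq ?_).congr_fderiv ?_
  · filter_upwards [hU.mem_nhds hx] with y hy using hf y hy
  · rw [hf x hx, Real.rpow_sub_one (hpos x hx).ne']
    ext X
    simp
    have := (hpos x hx).ne'
    field_simp

end Power

/-! ### The pseudo-Euclidean form, and the constants. -/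

theorem isInvertible_pseudoEuclidean {n : ℕ} {ε : Fin n → ℝ} (hε : ∀ i, ε i ≠ 0) :
    (pseudoEuclidean ε).IsInvertible := by
  refine isInvertible_of_nondegenerate _ fun v hv => ?_
  ext i
  have := hv (EuclideanSpace.single i 1)
  simpa [pseudoEuclidean_apply, hε i] using this

theorem pseudoEuclidean_symm {n : ℕ} (ε : Fin n → ℝ) (v w : EuclideanSpace ℝ (Fin n)) :
    pseudoEuclidean ε v w = pseudoEuclidean ε w v := by
  simp only [pseudoEuclidean_apply, mul_comm (v _)]

end SemiRiem

/-- Multiplying by `n - 1` completes the square: the product equals `(n-2)((n-1)k - m)² + m² +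
(n-1)m`. -/
theorem discriminant_pos {n m : ℕ} (hn : 3 ≤ n) (hm : 1 ≤ m) (k : ℝ) :
    0 < ((n - 2) * k - m) ^ 2 + (m * (2 * k + 1) - (n - 2) * k ^ 2)
      + 2 * k * ((n - 2) * k - m) := by
  have hn' : (3 : ℝ) ≤ n := by exact_mod_cast hn
  have hm' : (1 : ℝ) ≤ m := by exact_mod_cast hm
  have h : 0 < ((n : ℝ) - 1) * (((n - 2) * k - m) ^ 2 + (m * (2 * k + 1) - (n - 2) * k ^ 2)
      + 2 * k * ((n - 2) * k - m)) := by
    have : 0 ≤ ((n : ℝ) - 2) * ((n - 1) * k - m) ^ 2 :=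
      mul_nonneg (by linarith) (sq_nonneg _)
    have : 0 < (m : ℝ) ^ 2 + (n - 1) * m :=
      add_pos (by positivity) (mul_pos (by linarith) (by linarith))
    linarith
  exact pos_of_mul_pos_right h (by linarith)

end

/-! ### The theorem. -/

theorem mainTheorem7 {n m : ℕ} (hn : 3 ≤ n) (hm : 1 ≤ m)
    (ε : Fin n → ℝ) (hε : ∀ i, ε i = 1 ∨ ε i = -1)
    (α : Fin n → ℝ) (i₀ : Fin n) (hα : ∑ i, ε i * α i ^ 2 = ε i₀)
    {F : Type*} [TopologicalSpace F] [ChartedSpace (EuclideanSpace ℝ (Fin m)) F]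
    [IsManifold (𝓡 m) ∞ F]
    (gF : F → EuclideanSpace ℝ (Fin m) →L[ℝ] EuclideanSpace ℝ (Fin m) →L[ℝ] ℝ) (hF : SemiRiem.IsRicciFlat (𝓡 m) gF)
    (k c c₁ c₂ c₃ : ℝ) (hk : 0 < k) (hc₁ : 0 < c₁) (hc₂ : 0 < c₂) (hc₃ : 0 < c₃)
    (a b N : ℝ) (ha : a = (n - 2) * k - m) (hb : b = m * (2 * k + 1) - (n - 2) * k ^ 2)
    (hka : k + a ≠ 0) (hN : N = (a ^ 2 - b) / (2 * (k + a)))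
    (ξ : EuclideanSpace ℝ (Fin n) → ℝ) (hξ : ∀ x, ξ x = ∑ i, α i * x i)
    (U : Set (EuclideanSpace ℝ (Fin n))) (hU : U = {x | 0 < (a - N) * ξ x + c})
    (f h φ : EuclideanSpace ℝ (Fin n) → ℝ)
    (hf : ∀ x ∈ U, f x = c₁ * ((a - N) * ξ x + c) ^ (-(1 / (a - N))))
    (hh : ∀ x ∈ U, h x = c₂ * ((a - N) * ξ x + c) ^ (-(N / (a - N))))
    (hφ : ∀ x ∈ U, φ x = c₃ * ((a - N) * ξ x + c) ^ (-(k / (a - N)))) :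
    0 < a ^ 2 + b + 2 * k * a ∧
    a - N = (a ^ 2 + b + 2 * k * a) / (2 * (k + a)) ∧ a - N ≠ 0 ∧
    (0 < k + a → U = {x | -(2 * c * (k + a) / (a ^ 2 + b + 2 * k * a)) < ξ x}) ∧
    (k + a < 0 → U = {x | ξ x < -(2 * c * (k + a) / (a ^ 2 + b + 2 * k * a))}) ∧
    U.Nonempty ∧
    ContDiffOn ℝ ∞ f U ∧ ContDiffOn ℝ ∞ h U ∧ ContDiffOn ℝ ∞ φ U ∧
    (∀ x ∈ U, 0 < f x ∧ 0 < h x ∧ 0 < φ x) ∧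
    SemiRiem.IsQuasiEinsteinOn ((𝓡 n).prod (𝓡 m))
      (SemiRiem.warped (SemiRiem.conformal ε φ) f gF) (fun p => h p.1) 1 0 (U ×ˢ Set.univ) := by
  have hpos : 0 < a ^ 2 + b + 2 * k * a := by
    rw [ha, hb]
    exact discriminant_pos hn hm k
  have hδ : a - N = (a ^ 2 + b + 2 * k * a) / (2 * (k + a)) := by
    rw [hN]
    field_simp
    ring
  have hδ0 : a - N ≠ 0 := by
    rw [hδ]
    exact div_ne_zero hpos.ne' (mul_ne_zero two_ne_zero hka)
  have hε0 : ∀ i, ε i ≠ 0 := fun i => by rcases hε i with h | h <;> rw [h] <;> norm_num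
  -- Factoring out the zero of the affine function shows that the sign of `k + a` decides which
  -- half-space `U` is.
  have hdef : ∀ x, (a - N) * ξ x + c
      = (a ^ 2 + b + 2 * k * a)
        * (ξ x - -(2 * c * (k + a) / (a ^ 2 + b + 2 * k * a))) / (2 * (k + a)) := by
    intro x
    rw [hδ]
    generalize a ^ 2 + b + 2 * k * a = Δ at hpos
    have := hpos.ne'
    field_simp
    ring
  set A : EuclideanSpace ℝ (Fin n) →L[ℝ] ℝ := ∑ i, α i • EuclideanSpace.proj i with hA
  have hξA : ξ = A := by
    funext x
    simp [hA, hξ]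
  set s : EuclideanSpace ℝ (Fin n) → ℝ := fun x => (a - N) * ξ x + c with hs
  have hsd : ContDiff ℝ ∞ s := by
    rw [hs, hξA]
    exact (contDiff_const.mul A.contDiff).add contDiff_const
  have hs' : ∀ x, HasFDerivAt s ((a - N) • A) x := fun x => by
    rw [hs, hξA]
    exact (A.hasFDerivAt.const_mul (a - N)).add_const c
  have hUs : ∀ x ∈ U, 0 < s x := fun x hx => by rwa [hU] at hx
  have hUo : IsOpen U := by
    rw [hU]
    exact isOpen_lt continuous_const hsd.continuous
  have hfs := SemiRiem.contDiffOn_const_mul_rpow hsd hUs hf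
  have hhs := SemiRiem.contDiffOn_const_mul_rpow hsd hUs hh
  have hφs := SemiRiem.contDiffOn_const_mul_rpow hsd hUs hφ
  have hfp : ∀ x ∈ U, 0 < f x := fun x hx => by
    rw [hf x hx]
    exact mul_pos hc₁ (Real.rpow_pos_of_pos (hUs x hx) _)
  have hhp : ∀ x ∈ U, 0 < h x := fun x hx => by
    rw [hh x hx]
    exact mul_pos hc₂ (Real.rpow_pos_of_pos (hUs x hx) _)
  have hφp : ∀ x ∈ U, 0 < φ x := fun x hx => by
    rw [hφ x hx]
    exact mul_pos hc₃ (Real.rpow_pos_of_pos (hUs x hx) _)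
  have hηi := SemiRiem.isInvertible_pseudoEuclidean hε0
  have hηs := SemiRiem.pseudoEuclidean_symm ε
  refine ⟨hpos, hδ, hδ0, fun hp => ?_, fun hp => ?_, ?_, hfs, hhs, hφs,
    fun x hx => ⟨hfp x hx, hhp x hx, hφp x hx⟩, ?_, ?_, fun p hp => hhp p.1 hp.1, ?_⟩
  · rw [hU]
    ext x
    rw [Set.mem_ofPred_eq, Set.mem_ofPred_eq]
    rw [hdef, div_pos_iff_of_pos_right (by linarith), mul_pos_iff_of_pos_left hpos, sub_pos]
  · rw [hU]
    ext x
    rw [Set.mem_ofPred_eq, Set.mem_ofPred_eq]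
    rw [hdef, mul_div_assoc, mul_pos_iff_of_pos_left hpos, div_pos_iff]
    constructor
    · rintro (⟨h1, h2⟩ | ⟨h1, h2⟩) <;> linarith
    · intro h1
      exact Or.inr ⟨by linarith, by linarith⟩
  -- If `α` were zero, its square norm `ε i₀` would vanish. As `ξ` is a nonzero functional, some
  -- multiple of a vector `x` with `ξ x ≠ 0` gives `s = 1`.
  · have hA0 : A ≠ 0 := by
      intro h0
      have hα0 : ∀ i, α i = 0 := fun i => by
        have := congrArg (fun T => T (EuclideanSpace.single i 1)) h0
        simpa [hA] using this
      apply hε0 i₀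
      rw [← hα]
      simp [hα0]
    obtain ⟨x, hx⟩ := A.exists_ne_zero hA0
    refine ⟨((1 - c) / ((a - N) * A x)) • x, ?_⟩
    rw [hU]
    have : s (((1 - c) / ((a - N) * A x)) • x) = 1 := by
      simp only [hs, hξA, map_smul, smul_eq_mul]
      field_simp
      ring
    exact one_pos.trans_eq this.symm
  · exact SemiRiem.isSemiRiemannianOn_warped hUo hηi hηs hφs hfs (fun x hx => (hφp x hx).ne')
      (fun x hx => (hfp x hx).ne') hF.semiRiemannian
  · exact hhs.contMDiffOn.comp contMDiffOn_fst fun p hp => hp.1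
  · intro p hp v w
    have hn := hUo.mem_nhds hp.1
    have hy := hF.semiRiemannian.smooth p.2 trivial
    -- The gradient of `ξ` has components `ε i * α i` because `ε i ^ 2 = 1`.
    have D : SemiRiem.PowerData (SemiRiem.pseudoEuclidean ε) A
        (WithLp.toLp 2 fun i => ε i * α i) s φ f (a - N) k
        (SemiRiem.inChart (𝓡 m) gF p.2) (p.1, extChartAt (𝓡 m) p.2 p.2) :=
      { inv := hηi
        symm := hηs
        grad := by
          ext x
          simp only [SemiRiem.pseudoEuclidean_apply, hA]
          simp
          refine Finset.sum_congr rfl fun i _ => ?_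
          rcases hε i with h | h <;> rw [h] <;> ring
        affine := hs' _
        ne := (hUs _ hp.1).ne'
        smooth_φ := hφs.contDiffAt hn
        smooth_f := hfs.contDiffAt hn
        deriv_φ := Filter.mem_of_superset hn fun x hx => ⟨(hφp x hx).ne',
          SemiRiem.hasPowerFDerivAt_const_mul_rpow hUo hδ0 hs' hUs hφ hx⟩
        deriv_f := Filter.mem_of_superset hn fun x hx => ⟨(hfp x hx).ne',
          SemiRiem.hasPowerFDerivAt_const_mul_rpow hUo hδ0 hs' hUs hf hx⟩
        smooth_F := hy
        inv_F := by
          rw [SemiRiem.inChart_self]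
          exact SemiRiem.isInvertible_of_nondegenerate _
            (hF.semiRiemannian.nondegenerate p.2 trivial)
        symm_F := .of_forall fun y v w => hF.semiRiemannian.symm _ trivial _ _ }
    rw [SemiRiem.ricci_warped, SemiRiem.hess_warped, zero_mul]
    refine D.quasiEinstein (N := N) (Filter.mem_of_superset hn fun x hx =>
      SemiRiem.hasPowerFDerivAt_const_mul_rpow hUo hδ0 hs' hUs hh hx) (hhp _ hp.1).ne'
      (fun v w => hF.ricci_eq_zero p.2 v w) ?_ ?_ v w
    · simp [ha]
    -- With `δ = a - N` and `(n-2)k = a + m`, the second condition reduces to `2N(k + a) = a² - b`.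
    · simp only [finrank_euclideanSpace, Fintype.card_fin]
      have hN' : N * (2 * (k + a)) = a ^ 2 - b := by
        rw [hN]
        field_simp
      subst hb
      linear_combination -hN' - (a - N) * ha
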